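/- Let $G$ be a compactly generated, totally disconnected, locally compact group. A \emph{Cayley--Abels graph} for $G$ is a connected, locally finite graph (without loops or multiple edges) on which $G$ acts by automorphisms, transitively on the vertices, such that the stabilizers of vertices are compact open subgroups of $G$. Suppose that $G$ has a trivalent Cayley--Abels graph, i.e. one in which every vertex has exactly three neighbours. If $G$ is uniscalar, that is, every $g \in G$ normalizes some compact open subgroup of $G$ (which may depend on $g$), then $G$ has a compact open normal subgroup. -/

import Mathlib

/-- A topological group is compactly generated if it is generated, as an abstract group, by
some compact subset. -/
def IsCompactlyGeneratedGroup (G : Type*) [Group G] [TopologicalSpace G] : Prop :=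
  ∃ C : Set G, IsCompact C ∧ Subgroup.closure C = ⊤

/-- `Γ` is a Cayley–Abels graph for the topological group `G` (acting on the vertex set `V`):
`G` acts by graph automorphisms, transitively on the vertices, the graph is connected and
locally finite, and the vertex stabilizers are compact open subgroups of `G`. Graphs have
neither loops nor multiple edges. A right action is the same thing as a left action, through
`g ↦ g⁻¹`, with the same orbits and stabilizers. -/
structure IsCayleyAbelsGraph (G : Type*) [Group G] [TopologicalSpace G]
    {V : Type*} [MulAction G V] (Γ : SimpleGraph V) : Prop where
  adj_smul_iff : ∀ (g : G) (v w : V), Γ.Adj (g • v) (g • w) ↔ Γ.Adj v w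
  transitive : MulAction.IsPretransitive G V
  connected : Γ.Connected
  locallyFinite : ∀ v : V, (Γ.neighborSet v).Finite
  isCompact_stabilizer : ∀ v : V, IsCompact (MulAction.stabilizer G v : Set G)
  isOpen_stabilizer : ∀ v : V, IsOpen (MulAction.stabilizer G v : Set G)

/-- A graph is trivalent if every vertex has exactly three neighbours. -/
def IsTrivalent {V : Type*} (Γ : SimpleGraph V) : Prop :=
  ∀ v : V, (Γ.neighborSet v).encard = 3

/-- A topological group is uniscalar if each of its elements normalizes some compact open
subgroup (which may depend on the element). -/
def IsUniscalar (G : Type*) [Group G] [TopologicalSpace G] : Prop :=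
  ∀ g : G, ∃ U : Subgroup G, IsCompact (U : Set G) ∧ IsOpen (U : Set G) ∧
    g ∈ Subgroup.normalizer (U : Set G)

/-! Uniscalarity bounds the number of cosets of `L` in `L hᵏ L` independently of `k`, for `L`
compact open. Hence no `h` conjugates a compact open subgroup properly into itself
(`mem_normalizer_of_conj_mem`).

The engine is `exists_compact_open_normalized`, for `L ∩ hLh⁻¹` of index at most two in `L`. Put
`L_k = ⋂_{i ≤ k} hⁱLh⁻ⁱ`; consecutive indices are at most two. If the chain stops, its last term is
normalized by `L` and `h`. If it never stops, `(Lh)ᵏL = LhᵏL` has boundedly many cosets, so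
`(Lh)ᴷ⁺¹L = h(Lh)ᴷL` for some `K`, and the stabilizer of `(Lh)ᴷL` under left translation serves.

The rest is the action of `G_v` on the three neighbours of `v`. If it is trivial, `G_v` is normal;
if it is regular, an arc stabilizer is. If it has order two, the engine is applied to `L = G_v`; if
it is the full symmetric group, to an arc stabilizer. The resulting normalizer, after a correction
in the order two case, contains `G_v` and moves `v` to each neighbour, so by connectedness it is
`G`. -/

open scoped Pointwise

/-! ### Coset counting and uniscalarity -/

/-- If `W` and `L` are compact open subgroups, the number of left cosets of `L` in the double
coset `L n L` is bounded uniformly in `n` normalizing `W`. -/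
theorem exists_card_doubleCoset_le {G : Type*} [Group G] [TopologicalSpace G]
    [IsTopologicalGroup G] {W L : Subgroup G} (hWc : IsCompact (W : Set G))
    (hWo : IsOpen (W : Set G)) (hLc : IsCompact (L : Set G)) (hLo : IsOpen (L : Set G)) :
    ∃ b : ℕ, ∀ n ∈ Subgroup.normalizer (W : Set G),
      ∃ F : Finset (G ⧸ L), F.card ≤ b ∧ ∀ a ∈ L, ((a * n : G) : G ⧸ L) ∈ F := by
  classical
  obtain ⟨S, hS⟩ := compact_covered_by_mul_left_translates hLc
    (V := W) (by rw [hWo.interior_eq]; exact ⟨1, W.one_mem⟩)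
  obtain ⟨R, hR⟩ := compact_covered_by_mul_left_translates hWc
    (V := L) (by rw [hLo.interior_eq]; exact ⟨1, L.one_mem⟩)
  -- If `a = s⁻¹w` and `n⁻¹wn = r⁻¹l` with `w ∈ W`, `l ∈ L`, then `anL = s⁻¹nr⁻¹L`.
  refine ⟨S.card * R.card, fun n hn => ⟨(S ×ˢ R).image
    fun p => ((p.1⁻¹ * n * p.2⁻¹ : G) : G ⧸ L), ?_, fun a ha => ?_⟩⟩
  · exact Finset.card_image_le.trans (Finset.card_product S R).le
  · obtain ⟨s, hs, hsa⟩ : ∃ s ∈ S, s * a ∈ W := by simpa using hS ha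
    have hw : n⁻¹ * (s * a) * n ∈ W := (Subgroup.mem_normalizer_iff''.1 hn _).1 hsa
    obtain ⟨r, hr, hra⟩ : ∃ r ∈ R, r * (n⁻¹ * (s * a) * n) ∈ L := by simpa using hR hw
    refine Finset.mem_image.2 ⟨(s, r), Finset.mk_mem_product hs hr, ?_⟩
    rw [QuotientGroup.eq]
    convert hra using 1
    group

/-- A compact open subgroup that is mapped into itself under conjugation by the inverse of an
element `h` normalizing some compact open subgroup is normalized by `h`. -/
theorem mem_normalizer_of_conj_mem {G : Type*} [Group G] [TopologicalSpace G]
    [IsTopologicalGroup G] {H : Subgroup G} (hHc : IsCompact (H : Set G))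
    (hHo : IsOpen (H : Set G)) {h : G}
    (hu : ∃ U : Subgroup G, IsCompact (U : Set G) ∧ IsOpen (U : Set G) ∧
      h ∈ Subgroup.normalizer (U : Set G))
    (hle : ∀ a ∈ H, h⁻¹ * a * h ∈ H) : h ∈ Subgroup.normalizer (H : Set G) := by
  classical
  obtain ⟨W, hWc, hWo, hW⟩ := hu
  obtain ⟨b, hb⟩ := exists_card_doubleCoset_le hWc hWo hHc hHo
  have hpow : ∀ (j : ℕ), ∀ a ∈ H, (h ^ j)⁻¹ * a * h ^ j ∈ H := by
    intro j
    induction j with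
    | zero => simp
    | succ j ih =>
      intro a ha
      have := hle _ (ih a ha)
      convert this using 1
      rw [pow_succ]; group
  refine Subgroup.mem_normalizer_iff''.2 fun x => ⟨hle x, fun hx => ?_⟩
  by_contra hxH
  -- `y := h⁻¹ x h` lies in `H` but its conjugate by `h` does not
  set y := h⁻¹ * x * h with hy
  obtain ⟨F, hF, hmem⟩ := hb ((h ^ (b + 1))⁻¹)
    (inv_mem (pow_mem hW _))
  -- One coset more than the bound allows. If those of `i < j` agreed, conjugating down to exponent
  -- `i + 1` would put `x = hyh⁻¹` in `H`.
  let f : Fin (b + 1) → G ⧸ H :=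
    fun j => (((h ^ (j : ℕ))⁻¹ * y * h ^ (j : ℕ) * (h ^ (b + 1))⁻¹ : G) : G ⧸ H)
  have key : ∀ i j : Fin (b + 1), i < j → f i ≠ f j := by
    intro i j hij heq
    rw [QuotientGroup.eq] at heq
    obtain ⟨m, hm⟩ : ∃ m : ℕ, b + 1 = i + 1 + m := ⟨b - i, by omega⟩
    obtain ⟨l, hl⟩ : ∃ l : ℕ, (j : ℕ) = i + 1 + l := ⟨j - i - 1, by omega⟩
    have h1 := hpow m _ heq
    have h2 := hpow l _ hx
    apply hxH
    have em : h ^ (b + 1) = h ^ m * (h * h ^ (i : ℕ)) := by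
      rw [← pow_succ', ← pow_add]; congr 1; omega
    have el : h ^ (j : ℕ) = h ^ l * (h * h ^ (i : ℕ)) := by
      rw [← pow_succ', ← pow_add]; congr 1; omega
    rw [em, el] at h1
    have h3 := H.mul_mem h2 (H.inv_mem h1)
    convert h3 using 1
    simp only [hy]
    group
  have hinj : Function.Injective f := by
    intro i j heq
    rcases lt_trichotomy i j with hij | hij | hij
    · exact absurd heq (key i j hij)
    · exact hij
    · exact absurd heq.symm (key j i hij)
  have hcard := Finset.card_le_card_of_injOn (s := Finset.univ) (t := F) f
    (fun j _ => hmem _ (hpow j y hx)) hinj.injOn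
  simp at hcard
  omega

/-! ### The descending chain of intersected conjugates -/

/-- The intersection of the conjugates `h ^ i L h ^ (-i)` for `0 ≤ i ≤ k`. -/
def conjInter {G : Type*} [Group G] (L : Subgroup G) (h : G) (k : ℕ) : Subgroup G :=
  ⨅ i : Fin (k + 1), L.comap (MulAut.conj (h ^ (i : ℕ))⁻¹).toMonoidHom

section conjInter

variable {G : Type*} [Group G] {L : Subgroup G} {h : G}

theorem mem_conjInter {k : ℕ} {a : G} :
    a ∈ conjInter L h k ↔ ∀ i ≤ k, (h ^ i)⁻¹ * a * h ^ i ∈ L := by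
  simp only [conjInter, Subgroup.mem_iInf, Subgroup.mem_comap, MulEquiv.coe_toMonoidHom,
    MulAut.conj_apply, inv_inv, Fin.forall_iff, Nat.lt_succ_iff]

theorem conjInter_zero : conjInter L h 0 = L := by
  ext a; simp [mem_conjInter]

theorem mem_conjInter_succ {k : ℕ} {a : G} :
    a ∈ conjInter L h (k + 1) ↔
      a ∈ conjInter L h k ∧ (h ^ (k + 1))⁻¹ * a * h ^ (k + 1) ∈ L := by
  simp only [mem_conjInter]
  refine ⟨fun H => ⟨fun i hi => H i (by omega), H _ le_rfl⟩, fun H i hi => ?_⟩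
  rcases Nat.le_succ_iff.1 hi with hi | rfl
  · exact H.1 i hi
  · exact H.2

theorem mem_conjInter_succ' {k : ℕ} {a : G} :
    a ∈ conjInter L h (k + 1) ↔ a ∈ L ∧ h⁻¹ * a * h ∈ conjInter L h k := by
  have e : ∀ i : ℕ, (h ^ i)⁻¹ * (h⁻¹ * a * h) * h ^ i = (h ^ (i + 1))⁻¹ * a * h ^ (i + 1) := by
    intro i; rw [pow_succ']; group
  simp only [mem_conjInter, e]
  refine ⟨fun H => ⟨by simpa using H 0 (by omega), fun i hi => H _ (by omega)⟩,
    fun H i hi => ?_⟩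
  cases i with
  | zero => simpa using H.1
  | succ i => exact H.2 i (by omega)

theorem conjInter_succ_le (k : ℕ) : conjInter L h (k + 1) ≤ conjInter L h k :=
  fun _ ha => (mem_conjInter_succ.1 ha).1

theorem isOpen_conjInter [TopologicalSpace G] [IsTopologicalGroup G]
    (hLo : IsOpen (L : Set G)) (k : ℕ) : IsOpen (conjInter L h k : Set G) := by
  have : (conjInter L h k : Set G) =
      ⋂ i : Fin (k + 1), (fun a => (h ^ (i : ℕ))⁻¹ * a * h ^ (i : ℕ)) ⁻¹' (L : Set G) := by
    ext a; simp [mem_conjInter, Fin.forall_iff]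
  rw [this]
  exact isOpen_iInter_of_finite fun i => hLo.preimage (by fun_prop)

theorem isCompact_conjInter [TopologicalSpace G] [IsTopologicalGroup G]
    (hLc : IsCompact (L : Set G)) (hLo : IsOpen (L : Set G)) (k : ℕ) :
    IsCompact (conjInter L h k : Set G) := by
  refine hLc.of_isClosed_subset
    (Subgroup.isClosed_of_isOpen _ (isOpen_conjInter hLo k)) fun a ha => ?_
  simpa using mem_conjInter.1 ha 0 (by omega)

/-- If `L ∩ h L h⁻¹` has index at most two in `L`, the same holds for consecutive terms of the
sequence `conjInter L h`. -/
theorem inv_mul_mem_conjInter_succ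
    (h2 : ∀ a ∈ L, ∀ b ∈ L, h⁻¹ * a * h ∉ L → h⁻¹ * b * h ∉ L → h⁻¹ * (a⁻¹ * b) * h ∈ L)
    {k : ℕ} {a b : G} (ha : a ∈ conjInter L h k) (hb : b ∈ conjInter L h k)
    (ha' : a ∉ conjInter L h (k + 1)) (hb' : b ∉ conjInter L h (k + 1)) :
    a⁻¹ * b ∈ conjInter L h (k + 1) := by
  have e : ∀ x : G, (h ^ (k + 1))⁻¹ * x * h ^ (k + 1) =
      h⁻¹ * ((h ^ k)⁻¹ * x * h ^ k) * h := by
    intro x; rw [pow_succ]; group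
  rw [mem_conjInter_succ, e] at ha' hb' ⊢
  refine ⟨mul_mem (inv_mem ha) hb, ?_⟩
  have := h2 _ (mem_conjInter.1 ha k le_rfl) _ (mem_conjInter.1 hb k le_rfl)
    (fun H => ha' ⟨ha, H⟩) (fun H => hb' ⟨hb, H⟩)
  convert this using 1
  group

/-- If the sequence `conjInter L h` becomes stationary at `k`, and not before, and if `h`
normalizes `conjInter L h k`, then so does `L`. -/
theorem le_normalizer_conjInter
    (h2 : ∀ a ∈ L, ∀ b ∈ L, h⁻¹ * a * h ∉ L → h⁻¹ * b * h ∉ L → h⁻¹ * (a⁻¹ * b) * h ∈ L)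
    {k : ℕ} (hk : ∀ j < k, ¬ conjInter L h j ≤ conjInter L h (j + 1))
    (hh : h ∈ Subgroup.normalizer (conjInter L h k : Set G)) :
    L ≤ Subgroup.normalizer (conjInter L h k : Set G) := by
  have main : ∀ d j : ℕ, j + d = k →
      conjInter L h j ≤ Subgroup.normalizer (conjInter L h k : Set G) := by
    intro d
    induction d with
    | zero =>
      rintro j rfl
      exact Subgroup.le_normalizer
    | succ d ih =>
      intro j hj
      have ih' := ih (j + 1) (by omega)
      -- Since `L_{j+1}` has index two in `L_j`, one such `z` suffices. For `j + 1 = k` index two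
      -- means normal; otherwise `z = h⁻¹xh` with `x ∈ L_{j+1} \ L_{j+2}`.
      obtain ⟨z, hz, hzj⟩ : ∃ z ∈ Subgroup.normalizer (conjInter L h k : Set G),
          z ∈ conjInter L h j ∧ z ∉ conjInter L h (j + 1) := by
        cases d with
        | zero =>
          obtain rfl : k = j + 1 := by omega
          obtain ⟨a, ha, ha'⟩ := SetLike.not_le_iff_exists.1 (hk j (by omega))
          refine ⟨a, ?_, ha, ha'⟩
          have hconj : ∀ c ∈ conjInter L h j, c ∉ conjInter L h (j + 1) →
              ∀ n ∈ conjInter L h (j + 1), c * n * c⁻¹ ∈ conjInter L h (j + 1) := by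
            intro c hc hc' n hn
            have := inv_mul_mem_conjInter_succ h2 (inv_mem hc)
              (mul_mem (conjInter_succ_le j hn) (inv_mem hc))
              (fun H => hc' (by simpa using inv_mem H))
              (fun H => hc' (by simpa using mul_mem (inv_mem H) hn))
            simpa [mul_assoc] using this
          refine Subgroup.mem_normalizer_iff.2 fun n => ⟨hconj a ha ha' n, fun hn => ?_⟩
          have := hconj a⁻¹ (inv_mem ha) (fun H => ha' (by simpa using inv_mem H)) _ hn
          simpa [mul_assoc] using this
        | succ d =>
          obtain ⟨x, hx, hx'⟩ := SetLike.not_le_iff_exists.1 (hk (j + 1) (by omega))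
          have hxx := mem_conjInter_succ'.1 hx
          refine ⟨h⁻¹ * x * h, mul_mem (mul_mem (inv_mem hh) (ih' hx)) hh, hxx.2, fun H => ?_⟩
          exact hx' (mem_conjInter_succ'.2 ⟨hxx.1, H⟩)
      intro a ha
      by_cases haj : a ∈ conjInter L h (j + 1)
      · exact ih' haj
      · have := ih' (inv_mul_mem_conjInter_succ h2 ha hzj.1 haj hzj.2)
        have := mul_mem hz (inv_mem this)
        simpa using this
  simpa [conjInter_zero] using main k 0 (by omega)

end conjInter

/-! ### Double cosets and the subgroup normalized by `L` and `h` -/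

section

variable {G : Type*} [Group G] {L : Subgroup G} {h : G}

/-- If the sequence `conjInter L h` is strictly decreasing, with all indices two, then
`(L h) ^ k L` is contained in the double coset `L h ^ k L`. -/
theorem exists_eq_of_mem_pow_mul
    (h2 : ∀ a ∈ L, ∀ b ∈ L, h⁻¹ * a * h ∉ L → h⁻¹ * b * h ∉ L → h⁻¹ * (a⁻¹ * b) * h ∈ L)
    (hA : ∀ k, ¬ conjInter L h k ≤ conjInter L h (k + 1)) (k : ℕ) :
    ∀ g ∈ ((L : Set G) * {h}) ^ k * (L : Set G), ∃ a ∈ L, ∃ b ∈ L, g = a * h ^ k * b := by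
  induction k with
  | zero =>
    intro g hg
    exact ⟨1, L.one_mem, g, by simpa using hg, by simp⟩
  | succ k ih =>
    intro g hg
    rw [pow_succ, mul_assoc, mul_assoc, ← mul_assoc] at hg
    obtain ⟨e, he, c, ⟨x, hx, b, hb, rfl⟩, rfl⟩ := hg
    obtain rfl : h = x := hx.symm
    obtain ⟨a, ha, u, hu, rfl⟩ := ih e he
    -- write `u = y * u'` with `y` in the conjugate of `conjInter L h k` and `h⁻¹ u' h ∈ L`
    obtain ⟨y, hy, hyu⟩ : ∃ y, h ^ k * y * (h ^ k)⁻¹ ∈ L ∧ h⁻¹ * (y⁻¹ * u) * h ∈ L := by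
      by_cases huL : h⁻¹ * u * h ∈ L
      · exact ⟨1, by simp, by simpa using huL⟩
      -- Strictness at `k` yields an element of `L ∩ h⁻ᵏLhᵏ` outside `hLh⁻¹`, hence in the same
      -- nontrivial coset as `u`.
      · obtain ⟨z, hz, hz'⟩ := SetLike.not_le_iff_exists.1 (hA k)
        have hz0 : z ∈ L := by simpa using mem_conjInter.1 hz 0 (by omega)
        refine ⟨(h ^ k)⁻¹ * z * h ^ k, by convert hz0 using 1; group,
          h2 _ (mem_conjInter.1 hz k le_rfl) u hu (fun H => hz' ?_) huL⟩
        refine mem_conjInter_succ.2 ⟨hz, ?_⟩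
        convert H using 1
        rw [pow_succ]; group
    refine ⟨a * (h ^ k * y * (h ^ k)⁻¹), mul_mem ha hy, h⁻¹ * (y⁻¹ * u) * h * b,
      mul_mem hyu hb, ?_⟩
    rw [pow_succ]; simp only; group

/-- Let `L` be a compact open subgroup such that `L ∩ h L h⁻¹` has index at most two in `L`,
where `h` normalizes some compact open subgroup. Then some compact open subgroup is normalized
by both `L` and `h`. -/
theorem exists_compact_open_normalized [TopologicalSpace G] [IsTopologicalGroup G]
    (hLc : IsCompact (L : Set G)) (hLo : IsOpen (L : Set G))
    (hu : ∃ U : Subgroup G, IsCompact (U : Set G) ∧ IsOpen (U : Set G) ∧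
      h ∈ Subgroup.normalizer (U : Set G))
    (h2 : ∀ a ∈ L, ∀ b ∈ L, h⁻¹ * a * h ∉ L → h⁻¹ * b * h ∉ L →
      h⁻¹ * (a⁻¹ * b) * h ∈ L) :
    ∃ N : Subgroup G, IsCompact (N : Set G) ∧ IsOpen (N : Set G) ∧
      L ≤ Subgroup.normalizer (N : Set G) ∧ h ∈ Subgroup.normalizer (N : Set G) := by
  classical
  by_cases hB : ∃ k, conjInter L h k ≤ conjInter L h (k + 1)
  · have hk := Nat.find_spec hB
    have hmin : ∀ j < Nat.find hB, ¬ conjInter L h j ≤ conjInter L h (j + 1) :=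
      fun j hj => Nat.find_min hB hj
    set k := Nat.find hB
    have hc := isCompact_conjInter (h := h) hLc hLo k
    have ho := isOpen_conjInter (h := h) hLo k
    have hh := mem_normalizer_of_conj_mem hc ho hu
      fun a ha => (mem_conjInter_succ'.1 (hk ha)).2
    exact ⟨_, hc, ho, le_normalizer_conjInter h2 hmin hh, hh⟩
  · push Not at hB
    let Y : ℕ → Set G := fun k => ((L : Set G) * {h}) ^ k * (L : Set G)
    let π : G → G ⧸ L := fun g => (g : G ⧸ L)
    have hYL : ∀ k, Y k * (L : Set G) = Y k := fun k => by
      simp only [Y, mul_assoc, coe_mul_coe]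
    have hLY : ∀ k, (L : Set G) * Y k = Y k := fun k => by
      cases k with
      | zero => simp [Y]
      | succ k => simp only [Y, pow_succ', ← mul_assoc, coe_mul_coe]
    have hsucc : ∀ k, Y (k + 1) = Y k * ({h} * (L : Set G)) := fun k => by
      simp only [Y, pow_succ, mul_assoc]
    have hsucc' : ∀ k, Y (k + 1) = (L : Set G) * {h} * Y k := fun k => by
      simp only [Y, pow_succ', mul_assoc]
    have hsmul : ∀ k, h • Y k ⊆ Y (k + 1) := by
      rintro k _ ⟨y, hy, rfl⟩
      rw [hsucc', mul_assoc]
      exact ⟨1, L.one_mem, h * y, ⟨h, rfl, y, hy, rfl⟩, by simp⟩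
    have hsat : ∀ k g, π g ∈ π '' Y k → g ∈ Y k := by
      rintro k g ⟨y, hy, hyg⟩
      rw [← hYL]
      exact ⟨y, hy, y⁻¹ * g, QuotientGroup.eq.1 hyg, by simp⟩
    have hfin : ∃ b : ℕ, ∀ k, (π '' Y k).Finite ∧ (π '' Y k).ncard ≤ b := by
      obtain ⟨W, hWc, hWo, hW⟩ := hu
      obtain ⟨b, hb⟩ := exists_card_doubleCoset_le hWc hWo hLc hLo
      refine ⟨b, fun k => ?_⟩
      obtain ⟨F, hF, hmem⟩ := hb (h ^ k) (pow_mem hW k)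
      have hsub : π '' Y k ⊆ (F : Set (G ⧸ L)) := by
        rintro _ ⟨y, hy, rfl⟩
        obtain ⟨a, ha, b, hb, rfl⟩ := exists_eq_of_mem_pow_mul h2 hB k y hy
        have : π (a * h ^ k * b) = π (a * h ^ k) := 
          (QuotientGroup.eq.2 (by simpa [mul_assoc] using hb)).symm
        rw [this]
        exact hmem a ha
      refine ⟨F.finite_toSet.subset hsub, (Set.ncard_le_ncard hsub F.finite_toSet).trans ?_⟩
      rwa [Set.ncard_coe_finset]
    obtain ⟨b, hb⟩ := hfin
    obtain ⟨K, hK⟩ : ∃ K, (π '' Y (K + 1)).ncard ≤ (π '' Y K).ncard := by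
      by_contra! H
      have := (strictMono_nat_of_lt_succ H).le_apply (x := b + 1)
      have := (hb (b + 1)).2
      omega
    -- Translation by `h` preserves the number of cosets, so the inclusion `hY_K ⊆ Y_{K+1}` cannot
    -- be proper.
    have hstat : Y (K + 1) = h • Y K := by
      refine Set.Subset.antisymm (fun y hy => ?_) (hsmul K)
      have himg : π '' (h • Y K) = h • (π '' Y K) := by
        ext q
        constructor
        · rintro ⟨_, ⟨y, hy, rfl⟩, rfl⟩
          exact ⟨π y, ⟨y, hy, rfl⟩, rfl⟩
        · rintro ⟨_, ⟨y, hy, rfl⟩, rfl⟩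
          exact ⟨h • y, ⟨y, hy, rfl⟩, rfl⟩
      have heq : π '' (h • Y K) = π '' Y (K + 1) := by
        refine Set.eq_of_subset_of_ncard_le (Set.image_mono (hsmul K)) ?_ (hb _).1
        rw [himg, ← Set.image_smul, Set.ncard_image_of_injective _ (MulAction.injective h)]
        exact hK
      obtain ⟨_, ⟨y', hy', rfl⟩, he⟩ : π y ∈ π '' (h • Y K) := heq ▸ ⟨y, hy, rfl⟩
      refine ⟨h⁻¹ * y, hsat K _ ⟨y', hy', ?_⟩, by simp⟩
      have := QuotientGroup.eq.1 he
      exact QuotientGroup.eq.2 (by simpa [mul_assoc] using this)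
    let N : Subgroup G := MulAction.stabilizer G (Y K)
    have hLN : L ≤ N := fun a ha => by
      refine MulAction.mem_stabilizer_iff.2 ?_
      have : a • (L : Set G) = L := smul_coe_set ha
      rw [← hLY K, ← smul_mul_assoc, this]
    have hNo : IsOpen (N : Set G) := Subgroup.isOpen_mono hLN hLo
    have hYc : IsCompact (Y K) := by
      have hp : ∀ k, IsCompact (Y k) := fun k => by
        induction k with
        | zero => simpa [Y] using hLc
        | succ k ih => rw [hsucc]; exact ih.mul (isCompact_singleton.mul hLc)
      exact hp K
    obtain ⟨y, hy⟩ : (Y K).Nonempty := by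
      have hp : ∀ k, (Y k).Nonempty := fun k => by
        induction k with
        | zero => exact ⟨1, by simp [Y, L.one_mem]⟩
        | succ k ih => exact (ih.image _).mono (hsmul k)
      exact hp K
    have hNc : IsCompact (N : Set G) := by
      refine (hYc.mul (isCompact_singleton (x := y⁻¹))).of_isClosed_subset
        (Subgroup.isClosed_of_isOpen _ hNo) fun g hg => ?_
      have hg' : g • Y K = Y K := hg
      exact ⟨g * y, hg' ▸ ⟨y, hy, rfl⟩, y⁻¹, rfl, by simp⟩
    refine ⟨N, hNc, hNo, hLN.trans Subgroup.le_normalizer,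
      mem_normalizer_of_conj_mem hNc hNo hu fun g hg => ?_⟩
    have hg' : g • Y K = Y K := hg
    refine MulAction.mem_stabilizer_iff.2 ?_
    -- `hY_K = Y_K hL` trades left translation by `h` for right multiplication, which commutes with
    -- `g`.
    rw [mul_smul, mul_smul, ← hstat, hsucc, ← smul_mul_assoc, hg', ← hsucc, hstat,
      inv_smul_smul]

end

/-! ### Local actions on the three neighbours -/

section

variable {G : Type*} [Group G] {V : Type*} [MulAction G V] {Γ : SimpleGraph V}

/-- In a connected graph, a group of automorphisms containing the stabilizer of a vertex `v` and
elements that move `v` to each of its neighbours is everything. -/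
theorem eq_top_of_stabilizer_le (hadj : ∀ (g : G) (v w : V), Γ.Adj (g • v) (g • w) ↔ Γ.Adj v w)
    (hconn : Γ.Connected) {v : V} {M : Subgroup G} (hM : MulAction.stabilizer G v ≤ M)
    (hnb : ∀ x, Γ.Adj v x → ∃ m ∈ M, m • v = x) : M = ⊤ := by
  have walk : ∀ {a b : V}, Γ.Walk a b → (∃ m ∈ M, m • v = a) → ∃ m ∈ M, m • v = b := by
    intro a b p
    induction p with
    | nil => exact id
    | @cons a c b hac _ ih =>
      rintro ⟨m, hm, rfl⟩
      obtain ⟨n, hn, hnv⟩ := hnb (m⁻¹ • c) (by rwa [← hadj m, smul_inv_smul])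
      exact ih ⟨m * n, mul_mem hm hn, by rw [mul_smul, hnv, smul_inv_smul]⟩
  refine (Subgroup.eq_top_iff' M).2 fun g => ?_
  obtain ⟨p⟩ := hconn.preconnected v (g • v)
  obtain ⟨m, hm, hmv⟩ := walk p ⟨1, M.one_mem, one_smul G v⟩
  have : m⁻¹ * g ∈ M := hM (by rw [MulAction.mem_stabilizer_iff, mul_smul, ← hmv, inv_smul_smul])
  simpa using mul_mem hm this

theorem conj_mem_stabilizer_iff {g a : G} {v : V} :
    g⁻¹ * a * g ∈ MulAction.stabilizer G v ↔ a • g • v = g • v := by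
  rw [MulAction.mem_stabilizer_iff, mul_smul, mul_smul, inv_smul_eq_iff]

variable [TopologicalSpace G] [IsTopologicalGroup G]

/-- If a vertex stabilizer acts on the three neighbours of its vertex by fixing one and
interchanging the others, then a uniscalar group has a compact open normal subgroup. -/
theorem exists_normal_of_fixed_neighbor (hΓ : IsCayleyAbelsGraph G Γ) (hU : IsUniscalar G)
    {v w x y : V} (hxw : x ≠ w) (hyw : y ≠ w) (hxy : x ≠ y)
    (hnb : ∀ z, Γ.Adj v z ↔ z = w ∨ z = x ∨ z = y)
    (hw : ∀ a ∈ MulAction.stabilizer G v, a • w = w)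
    {σ : G} (hσ : σ ∈ MulAction.stabilizer G v) (hσx : σ • x = y) :
    ∃ N : Subgroup G, N.Normal ∧ IsCompact (N : Set G) ∧ IsOpen (N : Set G) := by
  have hc := hΓ.isCompact_stabilizer v
  have ho := hΓ.isOpen_stabilizer v
  have hperm : ∀ a ∈ MulAction.stabilizer G v, ∀ z, Γ.Adj v z → Γ.Adj v (a • z) := by
    intro a ha z hz
    have := (hΓ.adj_smul_iff a v z).2 hz
    rwa [MulAction.mem_stabilizer_iff.1 ha] at this
  have hadj' : ∀ g : G, Γ.Adj v (g • v) → Γ.Adj v (g⁻¹ • v) := by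
    intro g hg
    rw [← hΓ.adj_smul_iff g, smul_inv_smul]
    exact hg.symm
  have hσy : σ • y ≠ y := fun h => hxy (smul_left_cancel σ (hσx.trans h.symm))
  have hmove : ∀ a ∈ MulAction.stabilizer G v, a • x ≠ x → a • x = y := by
    intro a ha hax
    rcases (hnb _).1 (hperm a ha x ((hnb x).2 (by simp))) with h | h | h
    · exact absurd (smul_left_cancel a (h.trans (hw a ha).symm)) hxw
    · exact absurd h hax
    · exact h
  -- `t` interchanges `v` and `w`
  obtain ⟨t, htv⟩ := hΓ.transitive.exists_smul_eq v w
  have htN : t ∈ Subgroup.normalizer (MulAction.stabilizer G v : Set G) :=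
    mem_normalizer_of_conj_mem hc ho (hU t) fun a ha => by
      rw [conj_mem_stabilizer_iff, htv, hw a ha]
  have htw : t • w = v := by
    have hfix : σ • t⁻¹ • v = t⁻¹ • v := by
      have := (Subgroup.mem_normalizer_iff.1 htN σ).1 hσ
      rw [MulAction.mem_stabilizer_iff, mul_smul, mul_smul] at this
      exact eq_inv_smul_iff.2 this
    rcases (hnb _).1 (hadj' t ((hnb _).2 (Or.inl htv))) with h | h | h
    · rw [← h, smul_inv_smul]
    · rw [h] at hfix; exact absurd (hσx.symm.trans hfix).symm hxy
    · rw [h] at hfix; exact absurd hfix hσy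
  have htt : t * t ∈ MulAction.stabilizer G v := by
    rw [MulAction.mem_stabilizer_iff, mul_smul, htv, htw]
  -- `g` interchanges `v` and `x`
  obtain ⟨g, hgv, hgx⟩ : ∃ g : G, g • v = x ∧ g • x = v := by
    obtain ⟨g, hgv⟩ := hΓ.transitive.exists_smul_eq v x
    rcases (hnb _).1 (hadj' g ((hnb _).2 (Or.inr (Or.inl hgv)))) with h | h | h
    -- Here `G_v` fixes `g⁻¹v = w`, so `g` normalizes `G_v` and `σ` would fix `gv = x`.
    · exfalso
      have hgN : g⁻¹ ∈ Subgroup.normalizer (MulAction.stabilizer G v : Set G) :=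
        mem_normalizer_of_conj_mem hc ho (hU g⁻¹) fun a ha => by
          rw [conj_mem_stabilizer_iff, h, hw a ha]
      have := (Subgroup.mem_normalizer_iff''.1 (inv_mem_iff.1 hgN) σ).1 hσ
      rw [conj_mem_stabilizer_iff, hgv, hσx] at this
      exact hxy this.symm
    · exact ⟨g, hgv, by rw [← h, smul_inv_smul]⟩
    · exact ⟨g * σ, by rw [mul_smul, MulAction.mem_stabilizer_iff.1 hσ, hgv],
        by rw [mul_smul, hσx, ← h, smul_inv_smul]⟩
  have hgg : g * g ∈ MulAction.stabilizer G v := by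
    rw [MulAction.mem_stabilizer_iff, mul_smul, hgv, hgx]
  have hconj : ∀ a, (g * t)⁻¹ * a * (g * t) ∈ MulAction.stabilizer G v ↔ a • x = x := by
    intro a
    have e : (g * t)⁻¹ * a * (g * t) = t⁻¹ * (g⁻¹ * a * g) * t := by group
    rw [e, ← Subgroup.mem_normalizer_iff''.1 htN, conj_mem_stabilizer_iff, hgv]
  obtain ⟨N, hNc, hNo, hLN, hhN⟩ := exists_compact_open_normalized hc ho (hU (g * t))
    (fun a ha b hb ha' hb' => by
      rw [hconj] at ha' hb' ⊢
      rw [mul_smul, hmove b hb hb', ← hmove a ha ha', inv_smul_smul])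
  have hNt : ∀ m ∈ Subgroup.normalizer (N : Set G),
      t⁻¹ * m * t ∈ Subgroup.normalizer (N : Set G) → m ∈ Subgroup.normalizer
        ((N ⊓ N.comap (MulAut.conj t⁻¹).toMonoidHom : Subgroup G) : Set G) := by
    intro m hm hm'
    refine Subgroup.mem_normalizer_iff.2 fun n => ?_
    simp only [Subgroup.mem_inf, Subgroup.mem_comap, MulEquiv.coe_toMonoidHom,
      MulAut.conj_apply, inv_inv]
    rw [Subgroup.mem_normalizer_iff.1 hm n, Subgroup.mem_normalizer_iff.1 hm' (t⁻¹ * n * t)]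
    have e : t⁻¹ * m * t * (t⁻¹ * n * t) * (t⁻¹ * m * t)⁻¹ = t⁻¹ * (m * n * m⁻¹) * t := by group
    rw [e]
  -- `N` need not be normalized by `t`, but `N ∩ tNt⁻¹` is, because `t² ∈ G_v` normalizes `N`.
  set N' : Subgroup G := N ⊓ N.comap (MulAut.conj t⁻¹).toMonoidHom with hN'
  have hUN' : MulAction.stabilizer G v ≤ Subgroup.normalizer (N' : Set G) := fun a ha =>
    hNt a (hLN ha) (hLN ((Subgroup.mem_normalizer_iff''.1 htN a).1 ha))
  have hhN' : g * t ∈ Subgroup.normalizer (N' : Set G) := by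
    refine hNt _ hhN ?_
    have e : t⁻¹ * (g * t) * t = (g * t)⁻¹ * (g * g) * (t * t) := by group
    rw [e]
    exact mul_mem (mul_mem (inv_mem hhN) (hLN hgg)) (hLN htt)
  have htN' : t ∈ Subgroup.normalizer (N' : Set G) := by
    refine Subgroup.mem_normalizer_iff.2 fun n => ?_
    simp only [hN', Subgroup.mem_inf, Subgroup.mem_comap, MulEquiv.coe_toMonoidHom,
      MulAut.conj_apply, inv_inv]
    rw [Subgroup.mem_normalizer_iff.1 (hLN htt) (t⁻¹ * n * t)]
    have e₁ : t * t * (t⁻¹ * n * t) * (t * t)⁻¹ = t * n * t⁻¹ := by group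
    have e₂ : t⁻¹ * (t * n * t⁻¹) * t = n := by group
    rw [e₁, e₂, and_comm]
  have hgN' : g ∈ Subgroup.normalizer (N' : Set G) := by
    simpa using mul_mem hhN' (inv_mem htN')
  have hN'o : IsOpen (N' : Set G) := by
    refine hNo.inter (hNo.preimage (f := fun n => t⁻¹ * n * t⁻¹⁻¹) (by fun_prop))
  refine ⟨N', Subgroup.normalizer_eq_top_iff.1 (eq_top_of_stabilizer_le hΓ.adj_smul_iff
    hΓ.connected hUN' fun z hz => ?_), hNc.of_isClosed_subset
    (Subgroup.isClosed_of_isOpen _ hN'o) fun n hn => hn.1, hN'o⟩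
  rcases (hnb z).1 hz with rfl | rfl | rfl
  · exact ⟨t, htN', htv⟩
  · exact ⟨g, hgN', hgv⟩
  · exact ⟨σ * g, mul_mem (hUN' hσ) hgN', by rw [mul_smul, hgv, hσx]⟩

/-- If a vertex stabilizer acts transitively on the three neighbours of its vertex, then a
uniscalar group has a compact open normal subgroup. -/
theorem exists_normal_of_transitive_neighbors (hΓ : IsCayleyAbelsGraph G Γ) (hU : IsUniscalar G)
    {v w x y : V} (hxw : x ≠ w) (hyw : y ≠ w) (hxy : x ≠ y)
    (hnb : ∀ z, Γ.Adj v z ↔ z = w ∨ z = x ∨ z = y)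
    {σ ρ : G} (hσ : σ ∈ MulAction.stabilizer G v) (hσw : σ • w = x)
    (hρ : ρ ∈ MulAction.stabilizer G v) (hρw : ρ • w = y) :
    ∃ N : Subgroup G, N.Normal ∧ IsCompact (N : Set G) ∧ IsOpen (N : Set G) := by
  have hperm : ∀ a ∈ MulAction.stabilizer G v, ∀ z, Γ.Adj v z → Γ.Adj v (a • z) := by
    intro a ha z hz
    have := (hΓ.adj_smul_iff a v z).2 hz
    rwa [MulAction.mem_stabilizer_iff.1 ha] at this
  -- `t` interchanges `v` and `w`
  obtain ⟨t, htv, htw⟩ : ∃ t : G, t • v = w ∧ t • w = v := by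
    obtain ⟨t, htv⟩ := hΓ.transitive.exists_smul_eq v w
    have hadj : Γ.Adj v (t⁻¹ • v) := by
      rw [← hΓ.adj_smul_iff t, smul_inv_smul, htv]
      exact ((hnb w).2 (by simp)).symm
    obtain ⟨u, hu, huw⟩ : ∃ u ∈ MulAction.stabilizer G v, u • w = t⁻¹ • v := by
      rcases (hnb _).1 hadj with h | h | h
      · exact ⟨1, one_mem _, by rw [h, one_smul]⟩
      · exact ⟨σ, hσ, hσw.trans h.symm⟩
      · exact ⟨ρ, hρ, hρw.trans h.symm⟩
    exact ⟨t * u, by rw [mul_smul, MulAction.mem_stabilizer_iff.1 hu, htv],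
      by rw [mul_smul, huw, smul_inv_smul]⟩
  set L : Subgroup G := MulAction.stabilizer G v ⊓ MulAction.stabilizer G w
  have hLo : IsOpen (L : Set G) := (hΓ.isOpen_stabilizer v).inter (hΓ.isOpen_stabilizer w)
  have hLc : IsCompact (L : Set G) := (hΓ.isCompact_stabilizer v).of_isClosed_subset
    (Subgroup.isClosed_of_isOpen _ hLo) fun a ha => ha.1
  have memL : ∀ a, a ∈ L ↔ a • v = v ∧ a • w = w := fun a => Iff.rfl
  have hmove : ∀ a ∈ L, a • x ≠ x → a • x = y := by
    intro a ha hax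
    rcases (hnb _).1 (hperm a ha.1 x ((hnb x).2 (by simp))) with h | h | h
    · exact absurd (smul_left_cancel a (h.trans ((memL a).1 ha).2.symm)) hxw
    · exact absurd h hax
    · exact h
  have htL : t ∈ Subgroup.normalizer (L : Set G) := by
    refine Subgroup.mem_normalizer_iff''.2 fun a => ?_
    have : t⁻¹ * a * t ∈ L ↔ a • t • v = t • v ∧ a • t • w = t • w :=
      and_congr conj_mem_stabilizer_iff conj_mem_stabilizer_iff
    rw [this, htv, htw, memL, and_comm]
  by_cases hfix : ∀ a ∈ L, a • x = x
  · have hfix' : ∀ a ∈ L, ∀ z, Γ.Adj v z → a • z = z := by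
      intro a ha z hz
      rcases (hnb z).1 hz with rfl | rfl | rfl
      · exact ((memL a).1 ha).2
      · exact hfix a ha
      · rcases (hnb _).1 (hperm a ha.1 z hz) with h | h | h
        · exact absurd (smul_left_cancel a (h.trans ((memL a).1 ha).2.symm)) hyw
        · exact absurd (smul_left_cancel a (h.trans (hfix a ha).symm)).symm hxy
        · exact h
    have hconj : ∀ m ∈ MulAction.stabilizer G v, ∀ a ∈ L, m⁻¹ * a * m ∈ L := by
      intro m hm a ha
      refine Subgroup.mem_inf.2 ⟨mul_mem (mul_mem (inv_mem hm) ha.1) hm, ?_⟩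
      rw [conj_mem_stabilizer_iff]
      exact hfix' a ha _ (hperm m hm w ((hnb w).2 (by simp)))
    have hUL : MulAction.stabilizer G v ≤ Subgroup.normalizer (L : Set G) := by
      refine fun m hm => Subgroup.mem_normalizer_iff''.2 fun a => ⟨hconj m hm a, fun ha => ?_⟩
      have := hconj m⁻¹ (inv_mem hm) _ ha
      simpa [mul_assoc] using this
    refine ⟨L, Subgroup.normalizer_eq_top_iff.1 (eq_top_of_stabilizer_le hΓ.adj_smul_iff
      hΓ.connected hUL fun z hz => ?_), hLc, hLo⟩
    rcases (hnb z).1 hz with rfl | rfl | rfl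
    · exact ⟨t, htL, htv⟩
    · exact ⟨σ * t, mul_mem (hUL hσ) htL, by rw [mul_smul, htv, hσw]⟩
    · exact ⟨ρ * t, mul_mem (hUL hρ) htL, by rw [mul_smul, htv, hρw]⟩
  · push Not at hfix
    obtain ⟨τ, hτ, hτx⟩ := hfix
    replace hτx := hmove τ hτ hτx
    -- `h` maps the arc `(w, v)` to the arc `(v, x)`
    obtain ⟨h, rfl⟩ : ∃ h, t = σ⁻¹ * h := ⟨σ * t, by simp⟩
    have hhv : h • v = x := by
      rw [mul_smul, inv_smul_eq_iff, hσw] at htv; exact htv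
    have hhw : h • w = v := by
      rw [mul_smul, inv_smul_eq_iff, MulAction.mem_stabilizer_iff.1 hσ] at htw; exact htw
    set t := σ⁻¹ * h
    have hconj : ∀ a, h⁻¹ * a * h ∈ L ↔ a • x = x ∧ a • v = v := by
      intro a
      have : h⁻¹ * a * h ∈ L ↔ a • h • v = h • v ∧ a • h • w = h • w :=
        and_congr conj_mem_stabilizer_iff conj_mem_stabilizer_iff
      rw [this, hhv, hhw]
    obtain ⟨N, hNc, hNo, hLN, hhN⟩ := exists_compact_open_normalized hLc hLo (hU h)
      (fun a ha b hb ha' hb' => by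
        have hax := hmove a ha fun H => ha' ((hconj a).2 ⟨H, ha.1⟩)
        have hbx := hmove b hb fun H => hb' ((hconj b).2 ⟨H, hb.1⟩)
        exact (hconj _).2 ⟨by rw [mul_smul, hbx, ← hax, inv_smul_smul],
          (mul_mem (inv_mem ha) hb).1⟩)
    refine ⟨N, Subgroup.normalizer_eq_top_iff.1 ?_, hNc, hNo⟩
    set Q := Subgroup.normalizer (N : Set G)
    -- the elements `z` and `t τ t⁻¹` of `Q` fix `w` and act transitively on its neighbours
    have hzQ : h⁻¹ * τ * h ∈ Q := mul_mem (mul_mem (inv_mem hhN) (hLN hτ)) hhN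
    have hzw : (h⁻¹ * τ * h) • w = w := by
      rw [mul_smul, mul_smul, hhw, MulAction.mem_stabilizer_iff.1 hτ.1, ← hhw, inv_smul_smul]
    have hzv : (h⁻¹ * τ * h) • v ≠ v := by
      rw [mul_smul, mul_smul, hhv, hτx, Ne, inv_smul_eq_iff, hhv]; exact hxy.symm
    set z := h⁻¹ * τ * h
    -- Although `t` is not yet known to lie in `Q`, this conjugate does, since `t` normalizes `L ≤
    -- Q`.
    have hτ'L : t * τ * t⁻¹ ∈ L := (Subgroup.mem_normalizer_iff.1 htL τ).1 hτ
    have hτy : τ • y = x := by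
      rcases (hnb _).1 (hperm τ hτ.1 y ((hnb y).2 (by simp))) with h' | h' | h'
      · exact absurd (smul_left_cancel τ (h'.trans ((memL τ).1 hτ).2.symm)) hyw
      · exact h'
      · exact absurd (smul_left_cancel τ (h'.trans hτx.symm)).symm hxy
    have hnbw : ∀ a ∈ MulAction.stabilizer G w, a • v ≠ v → a • v = t • x ∨ a • v = t • y := by
      intro a ha hav
      have h1 : Γ.Adj v (t⁻¹ • a • v) := by
        rw [← hΓ.adj_smul_iff t, smul_inv_smul, htv]
        have := (hΓ.adj_smul_iff a w v).2 ((hnb w).2 (by simp)).symm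
        rwa [MulAction.mem_stabilizer_iff.1 ha] at this
      simp only [hnb, inv_smul_eq_iff, htw] at h1
      tauto
    have hGw : MulAction.stabilizer G w ≤ Q := by
      intro a ha
      -- Modulo `L = G_v ∩ G_w`, an element of `G_w` is determined by its image of `v`.
      have red : ∀ q ∈ Q, q • w = w → q • v = a • v → a ∈ Q := by
        intro q hq hqw hqv
        have : q⁻¹ * a ∈ L := (memL _).2
          ⟨by rw [mul_smul, ← hqv, inv_smul_smul],
            by rw [mul_smul, MulAction.mem_stabilizer_iff.1 ha, inv_smul_eq_iff, hqw]⟩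
        simpa using mul_mem hq (hLN this)
      by_cases hav : a • v = v
      · exact hLN ⟨hav, ha⟩
      have hτz : (t * τ * t⁻¹ * z) • w = w := by
        rw [mul_smul, hzw]; exact hτ'L.2
      have hτzv : (t * τ * t⁻¹ * z) • v = t • τ • t⁻¹ • z • v := by simp only [mul_smul]
      rcases hnbw a ha hav with h1 | h1 <;> rcases hnbw z hzw hzv with h3 | h3
      · exact red z hzQ hzw (h3.trans h1.symm)
      · exact red _ (mul_mem (hLN hτ'L) hzQ) hτz (by
          rw [hτzv, h1, h3, inv_smul_smul, hτy])
      · exact red _ (mul_mem (hLN hτ'L) hzQ) hτz (by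
          rw [hτzv, h1, h3, inv_smul_smul, hτx])
      · exact red z hzQ hzw (h3.trans h1.symm)
    have hGv : MulAction.stabilizer G v ≤ Q := by
      intro a ha
      have : h⁻¹ * a * h ∈ Q := hGw (by
        rw [conj_mem_stabilizer_iff, hhw]; exact ha)
      have := mul_mem (mul_mem hhN this) (inv_mem hhN)
      simpa [mul_assoc] using this
    have htQ : t ∈ Q := mul_mem (inv_mem (hGv hσ)) hhN
    refine eq_top_of_stabilizer_le hΓ.adj_smul_iff hΓ.connected hGv fun z hz => ?_
    rcases (hnb z).1 hz with rfl | rfl | rfl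
    · exact ⟨t, htQ, htv⟩
    · exact ⟨h, hhN, hhv⟩
    · exact ⟨ρ * t, mul_mem (hGv hρ) htQ, by rw [mul_smul, htv, hρw]⟩

end

/-! ### Case distinction by local action -/

theorem corollary6p3 {G : Type*} [Group G] [TopologicalSpace G] [IsTopologicalGroup G]
    [LocallyCompactSpace G] [TotallyDisconnectedSpace G]
    (hG : IsCompactlyGeneratedGroup G)
    {V : Type*} [MulAction G V] (Γ : SimpleGraph V)
    (hΓ : IsCayleyAbelsGraph G Γ) (h3 : IsTrivalent Γ)
    (hU : IsUniscalar G) :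
    ∃ N : Subgroup G, N.Normal ∧ IsCompact (N : Set G) ∧ IsOpen (N : Set G) := by
  obtain ⟨v⟩ := hΓ.connected.nonempty
  obtain ⟨p, q, r, hpq, hpr, hqr, hset⟩ := Set.encard_eq_three.1 (h3 v)
  have hnb : ∀ z, Γ.Adj v z ↔ z = p ∨ z = q ∨ z = r := fun z => by
    rw [← SimpleGraph.mem_neighborSet, hset]; simp
  have hperm : ∀ a ∈ MulAction.stabilizer G v, ∀ z, Γ.Adj v z → Γ.Adj v (a • z) := by
    intro a ha z hz
    have := (hΓ.adj_smul_iff a v z).2 hz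
    rwa [MulAction.mem_stabilizer_iff.1 ha] at this
  by_cases hfix : ∀ z, Γ.Adj v z → ∀ a ∈ MulAction.stabilizer G v, a • z = z
  · have hc := hΓ.isCompact_stabilizer v
    have ho := hΓ.isOpen_stabilizer v
    refine ⟨MulAction.stabilizer G v, Subgroup.normalizer_eq_top_iff.1
      (eq_top_of_stabilizer_le hΓ.adj_smul_iff hΓ.connected Subgroup.le_normalizer
        fun z hz => ?_), hc, ho⟩
    obtain ⟨g, hg⟩ := hΓ.transitive.exists_smul_eq v z
    exact ⟨g, mem_normalizer_of_conj_mem hc ho (hU g) fun a ha => by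
      rw [conj_mem_stabilizer_iff, hg, hfix z hz a ha], hg⟩
  push Not at hfix
  obtain ⟨x, hx, σ, hσ, hσx⟩ := hfix
  -- name the remaining neighbours so that `σ` maps `x` to `y`
  obtain ⟨y, w, hσy, hxw, hyw, hxy, hnb'⟩ : ∃ y w, σ • x = y ∧ x ≠ w ∧ y ≠ w ∧ x ≠ y ∧
      ∀ z, Γ.Adj v z ↔ z = w ∨ z = x ∨ z = y := by
    have hx' := (hnb x).1 hx
    have hy' := (hnb _).1 (hperm σ hσ x hx)
    generalize σ • x = y at hσx hy'
    simp only [hnb]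
    rcases hx' with rfl | rfl | rfl <;> rcases hy' with rfl | rfl | rfl
    all_goals first
      | exact absurd rfl hσx
      | exact ⟨_, p, rfl, by tauto, by tauto, by tauto, fun z => by tauto⟩
      | exact ⟨_, q, rfl, by tauto, by tauto, by tauto, fun z => by tauto⟩
      | exact ⟨_, r, rfl, by tauto, by tauto, by tauto, fun z => by tauto⟩
  by_cases hw : ∀ a ∈ MulAction.stabilizer G v, a • w = w
  · exact exists_normal_of_fixed_neighbor hΓ hU hxw hyw hxy hnb' hw hσ hσy
  push Not at hw
  obtain ⟨ρ, hρ, hρw⟩ := hw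
  rcases (hnb' _).1 (hperm ρ hρ w ((hnb' w).2 (by simp))) with h | h | h
  · exact absurd h hρw
  · exact exists_normal_of_transitive_neighbors hΓ hU hxw hyw hxy hnb' hρ h
      (mul_mem hσ hρ) (by rw [mul_smul, h, hσy])
  · have hσ' : σ⁻¹ • y = x := by rw [← hσy, inv_smul_smul]
    exact exists_normal_of_transitive_neighbors hΓ hU hxw hyw hxy hnb'
      (mul_mem (inv_mem hσ) hρ) (by rw [mul_smul, h, hσ']) hρ h
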